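/- Consider the plant $\dot x=-ax+bu_1$, $y_1=x$ with $a\ge 0$, $b>0$, and the PI controller $\dot\xi=u_0$, $y_0=k_pu_0+k_i\xi$ with gains $k_p,k_i\ge 0$. They are interconnected through a communication channel with forward delay $h_1\ge 0$, return delay $h_2\ge 0$ and round-trip delay $h=h_1+h_2>0$, that is, $s_1^+(t)=s_0^+(t-h_1)$ and $s_0^-(t)=s_1^-(t-h_2)$, with the scattering transformations (with parameter $d>0$) $$\upsilon_0=\tfrac1d\mu_0-\tfrac1d s_0^-,\quad s_0^+=2\mu_0-s_0^-,\qquad \mu_1=-d\upsilon_1+s_1^+,\quad s_1^-=-2d\upsilon_1+s_1^+$$ at the channel end points and the interconnection $u_0=\upsilon_0-y_1^\star$, $\mu_0=-y_0$, $u_1=\mu_1$, $\upsilon_1=y_1$, where $y_1^\star$ is the reference. The characteristic roots of the closed loop are the numbers $s\in\mathbb C$ for which the loop with $y_1^\star=0$ has a nonzero trajectory whose signals are all constant multiples of $e^{st}$; equivalently, the zeros of the characteristic quasipolynomial $p(s)=p_2(s)s^2+p_1(s)s+p_0(s)$, where $$p_2=(1+e^{-hs})d+(1-e^{-hs})k_p,\quad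 p_1=(1+e^{-hs})(bk_p+a)d+(1-e^{-hs})(bd^2+ak_p+k_i),\quad p_0=(1+e^{-hs})bk_id+(1-e^{-hs})ak_i .$$ For $\sigma\in\mathbb R$ the closed loop is called $\sigma$-stable if all its characteristic roots have real part less than $-\sigma$. For $\zeta>0$, the decay rate $\sigma$ is called achievable with $d=\zeta k_p$ if there are gains $k_p,k_i\ge 0$ with $d=\zeta k_p>0$ for which the closed loop is $\sigma$-stable. Theorem 1. The equation $2(1+e^{\eta})+\eta(1-e^{\eta})=0$ has exactly one positive solution $\eta_{\sup}$. With $$\zeta_{\min}=\frac{(1+e^{\eta_{\sup}})^2}{2\eta_{\sup}e^{\eta_{\sup}}-(1+e^{\eta_{\sup}})(1-e^{\eta_{\sup}})}$$ one has $\eta_{\sup}\approx 2.3994$ and $\zeta_{\min}\approx 0.8336$, both with error at most $5\cdot 10^{-5}$. For all $a\ge 0$, $b>0$ and $h_1,h_2\ge 0$ with $h=h_1+h_2>0$, the least upper bound of the decay rates $\sigma$ that are achievable with $d=\zeta_{\min}k_p$ is $$\sigma_{\sup}=\frac{\eta_{\sup}}{h}.$$ Moreover, for all such $a,b,h_1,h_2$,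 the number $\zeta_{\min}$, which depends neither on the plant nor on the delays, is the least $\zeta>0$ such that every $\sigma<\sigma_{\sup}$ is achievable with $d=\zeta k_p$. -/

import Mathlib

/-- The signals of the control loop: plant state `x`, plant input and output `u1`, `y1`,
controller state `ξ`, controller input and output `u0`, `y0`, the power variables
`v0`, `mu0` (controller end) and `v1`, `mu1` (plant end) of the communication channel, and the
scattering variables `sp0 = s⁺(0,·)`, `sm0 = s⁻(0,·)`, `sp1 = s⁺(1,·)`, `sm1 = s⁻(1,·)`. -/
inductive Port : Type
  | x | u1 | y1 | ξ | u0 | y0 | v0 | mu0 | v1 | mu1 | sp0 | sm0 | sp1 | sm1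

/-- The real parameters: plant `a`, `b`; forward and return delays `h1`, `h2`; controller gains
`kp`, `ki`; scattering parameter `d`. -/
structure LoopParams : Type where
  a : ℝ
  b : ℝ
  h1 : ℝ
  h2 : ℝ
  kp : ℝ
  ki : ℝ
  d : ℝ

/-- `T` is a (complexified) trajectory of the closed loop with reference `yref`: first-order plant,
PI controller, scattering transformations at the two ends of the channel, the two delays, and the
interconnection. -/
structure IsClosedLoop (P : LoopParams) (yref : ℝ → ℂ) (T : Port → ℝ → ℂ) : Prop where
  plant_state : ∀ t, HasDerivAt (T .x) (-(P.a : ℂ) * T .x t + (P.b : ℂ) * T .u1 t) t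
  plant_output : ∀ t, T .y1 t = T .x t
  controller_state : ∀ t, HasDerivAt (T .ξ) (T .u0 t) t
  controller_output : ∀ t, T .y0 t = (P.kp : ℂ) * T .u0 t + (P.ki : ℂ) * T .ξ t
  scattering_v0 : ∀ t, T .v0 t = 1 / (P.d : ℂ) * T .mu0 t - 1 / (P.d : ℂ) * T .sm0 t
  scattering_sp0 : ∀ t, T .sp0 t = 2 * T .mu0 t - T .sm0 t
  scattering_mu1 : ∀ t, T .mu1 t = -(P.d : ℂ) * T .v1 t + T .sp1 t
  scattering_sm1 : ∀ t, T .sm1 t = -2 * (P.d : ℂ) * T .v1 t + T .sp1 t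
  delay_forward : ∀ t, T .sp1 t = T .sp0 (t - P.h1)
  delay_return : ∀ t, T .sm0 t = T .sm1 (t - P.h2)
  interconnection_u0 : ∀ t, T .u0 t = T .v0 t - yref t
  interconnection_mu0 : ∀ t, T .mu0 t = -T .y0 t
  interconnection_u1 : ∀ t, T .u1 t = T .mu1 t
  interconnection_v1 : ∀ t, T .v1 t = T .y1 t

/-- `s` is a characteristic root of the closed loop: the loop with zero reference has a nonzero
trajectory of the form `t ↦ A * exp (s * t)`. -/
def IsCharRoot (P : LoopParams) (s : ℂ) : Prop :=
  ∃ A : Port → ℂ, A ≠ 0 ∧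
    IsClosedLoop P (fun _ => 0) (fun i t => A i * Complex.exp (s * (t : ℂ)))

/-- The characteristic quasipolynomial `p₂(s) s² + p₁(s) s + p₀(s)` of the closed loop,
with `h = h1 + h2` the round-trip delay. -/
noncomputable def charQuasi (P : LoopParams) (s : ℂ) : ℂ :=
  let z := Complex.exp (-((P.h1 : ℂ) + (P.h2 : ℂ)) * s)
  let a : ℂ := P.a
  let b : ℂ := P.b
  let kp : ℂ := P.kp
  let ki : ℂ := P.ki
  let d : ℂ := P.d
  ((1 + z) * d + (1 - z) * kp) * s ^ 2
    + ((1 + z) * (b * kp + a) * d + (1 - z) * (b * d ^ 2 + a * kp + ki)) * s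
    + ((1 + z) * b * ki * d + (1 - z) * a * ki)

/-- The characteristic roots of the closed loop are the zeros of the characteristic
quasipolynomial. -/
theorem isCharRoot_iff (P : LoopParams) (hd : P.d ≠ 0) (s : ℂ) :
    IsCharRoot P s ↔ charQuasi P s = 0 := by
  have hd' : (P.d : ℂ) ≠ 0 := by exact_mod_cast hd
  have hder : ∀ (c : ℂ) (t : ℝ),
      HasDerivAt (fun t : ℝ => c * Complex.exp (s * (t : ℂ)))
        (c * (Complex.exp (s * (t : ℂ)) * s)) t := by
    intro c t
    have h1 : HasDerivAt (fun t : ℝ => s * (t : ℂ)) s t := by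
      simpa using (Complex.ofRealCLM.hasDerivAt (x := t)).const_mul s
    exact (h1.cexp).const_mul c
  have hz : Complex.exp (-((P.h1 : ℂ) + (P.h2 : ℂ)) * s)
      = Complex.exp (-(s * P.h1)) * Complex.exp (-(s * P.h2)) := by
    rw [← Complex.exp_add]; congr 1; ring
  simp only [charQuasi, hz]
  constructor
  · rintro ⟨A, hA, T⟩
    have e1 := (hder (A .x) 0).unique (T.plant_state 0)
    have e2 := (hder (A .ξ) 0).unique (T.controller_state 0)
    have e3 := T.plant_output 0
    have e4 := T.controller_output 0
    have e5 := T.scattering_v0 0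
    have e6 := T.scattering_sp0 0
    have e7 := T.scattering_mu1 0
    have e8 := T.scattering_sm1 0
    have e9 := T.delay_forward 0
    have e10 := T.delay_return 0
    have e11 := T.interconnection_u0 0
    have e12 := T.interconnection_mu0 0
    have e13 := T.interconnection_u1 0
    have e14 := T.interconnection_v1 0
    simp only [Complex.ofReal_zero, mul_zero, Complex.exp_zero, mul_one, one_mul, sub_zero,
      zero_sub, Complex.ofReal_neg, mul_neg] at e1 e2 e3 e4 e5 e6 e7 e8 e9 e10 e11 e12 e13 e14
    generalize Complex.exp (-(s * P.h1)) = z1 at *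
    generalize Complex.exp (-(s * P.h2)) = z2 at *
    have e5' : A .sm0 = A .mu0 - P.d * A .v0 := by
      field_simp at e5
      linear_combination e5
    have r1 : (s + P.a + P.b * P.d) * A .x
        = P.b * z1 * (P.d * s - (P.kp * s + P.ki)) * A .ξ := by
      rw [e13, e7, e14, e3, e9, e6, e5', e12, e4, ← e11, ← e2] at e1
      linear_combination e1
    have r2 : 2 * P.d * z2 * A .x
        = (P.kp * s + P.ki + P.d * s + z1 * z2 * (P.d * s - (P.kp * s + P.ki))) * A .ξ := by
      rw [e8, e14, e3, e9, e6, e5', e12, e4, ← e11, ← e2] at e10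
      linear_combination e10
    by_contra hp
    have hx : A .x = 0 := by
      refine (mul_eq_zero.mp ?_).resolve_left hp
      linear_combination (P.kp * s + P.ki + P.d * s
        + z1 * z2 * (P.d * s - (P.kp * s + P.ki))) * r1
        - P.b * z1 * (P.d * s - (P.kp * s + P.ki)) * r2
    have hξ : A .ξ = 0 := by
      refine (mul_eq_zero.mp ?_).resolve_left hp
      linear_combination 2 * P.d * z2 * r1 - (s + P.a + P.b * P.d) * r2
    apply hA
    have k2 : A .u0 = 0 := by rw [← e2, hξ]; ring
    have k3 : A .y1 = 0 := by rw [e3, hx]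
    have k4 : A .y0 = 0 := by rw [e4, k2, hξ]; ring
    have k5 : A .v0 = 0 := by rw [← e11, k2]
    have k6 : A .mu0 = 0 := by rw [e12, k4]; ring
    have k7 : A .sm0 = 0 := by rw [e5', k5, k6]; ring
    have k8 : A .sp0 = 0 := by rw [e6, k6, k7]; ring
    have k9 : A .sp1 = 0 := by rw [e9, k8]; ring
    have k10 : A .v1 = 0 := by rw [e14, k3]
    have k11 : A .mu1 = 0 := by rw [e7, k10, k9]; ring
    have k12 : A .sm1 = 0 := by rw [e8, k10, k9]; ring
    have k13 : A .u1 = 0 := by rw [e13, k11]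
    funext i
    cases i <;> assumption
  · intro hp
    have hdel : ∀ t h : ℝ, Complex.exp (s * ((t - h : ℝ) : ℂ))
        = Complex.exp (-(s * h)) * Complex.exp (s * t) := by
      intro t h
      rw [← Complex.exp_add]; congr 1; push_cast; ring
    have hz2 : Complex.exp (-(s * P.h2)) ≠ 0 := Complex.exp_ne_zero _
    have hdel1 := fun t => hdel t P.h1
    have hdel2 := fun t => hdel t P.h2
    generalize Complex.exp (-(s * P.h1)) = z1 at *
    generalize Complex.exp (-(s * P.h2)) = z2 at *
    obtain ⟨q, hq⟩ : ∃ q : ℂ, q = P.kp * s + P.ki := ⟨_, rfl⟩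
    obtain ⟨X, hX⟩ : ∃ X : ℂ, X = q + P.d * s + z1 * z2 * (P.d * s - q) := ⟨_, rfl⟩
    obtain ⟨Y, hY⟩ : ∃ Y : ℂ, Y = 2 * P.d * z2 := ⟨_, rfl⟩
    have hY0 : Y ≠ 0 := by rw [hY]; exact mul_ne_zero (mul_ne_zero two_ne_zero hd') hz2
    refine ⟨fun i => match i with
      | .x => X
      | .u1 => -P.d * X + z1 * ((P.d * s - q) * Y)
      | .y1 => X
      | .ξ => Y
      | .u0 => s * Y
      | .y0 => q * Y
      | .v0 => s * Y
      | .mu0 => -(q * Y)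
      | .v1 => X
      | .mu1 => -P.d * X + z1 * ((P.d * s - q) * Y)
      | .sp0 => (P.d * s - q) * Y
      | .sm0 => -(q + P.d * s) * Y
      | .sp1 => z1 * ((P.d * s - q) * Y)
      | .sm1 => -2 * P.d * X + z1 * ((P.d * s - q) * Y),
      fun h0 => hY0 (congrFun h0 Port.ξ), ?_⟩
    constructor <;> intro t <;> dsimp only
    · refine (hder X t).congr_deriv ?_
      rw [hX, hY, hq]
      linear_combination Complex.exp (s * t) * hp
    · refine (hder Y t).congr_deriv ?_
      ring
    · rw [hq]; ring
    · linear_combination (-(s * Y * Complex.exp (s * t))) * mul_inv_cancel₀ hd'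
    · ring
    · ring
    · ring
    · rw [hdel1]; ring
    · rw [hdel2, hX, hY]; ring
    · ring
    · ring

/-- `σ`-stability: all characteristic roots have real part less than `-σ`. -/
def SigmaStable (P : LoopParams) (σ : ℝ) : Prop :=
  ∀ s : ℂ, IsCharRoot P s → s.re < -σ

/-- With `d = ζ * kp`, some gains `kp, ki ≥ 0` make the closed loop `σ`-stable. The scattering
transformation requires `d > 0`. -/
def Achievable (a b h1 h2 ζ σ : ℝ) : Prop :=
  ∃ kp ki : ℝ, 0 ≤ kp ∧ 0 ≤ ki ∧ 0 < ζ * kp ∧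
    SigmaStable { a := a, b := b, h1 := h1, h2 := h2, kp := kp, ki := ki, d := ζ * kp } σ

/-- The defining equation of `η_sup`. -/
def EtaEq (η : ℝ) : Prop :=
  2 * (1 + Real.exp η) + η * (1 - Real.exp η) = 0

/-- `ζ_min` as a function of `η_sup`. -/
noncomputable def zetaOf (η : ℝ) : ℝ :=
  (1 + Real.exp η) ^ 2
    / (2 * η * Real.exp η - (1 + Real.exp η) * (1 - Real.exp η))

/-! By `charQuasi_eq` the quasipolynomial is a plant factor times a controller factor, minus `exp
(-h s)` times the same product with `d` negated. For `d = ζ kp`, `ζ < 1` and large `|s|`, it is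
governed by `exp (h s) = (1 - ζ) / (1 + ζ)`, whatever the gains. Hence a chain of roots approaches
the line `re s = -log ((1 + ζ) / (1 - ζ)) / h` and caps every decay rate (`Achievable.mul_le_log`).
The cap increases with `ζ` and equals `η_sup / h` at `ζ_min = 2 / η_sup`, which gives the upper
bound and the minimality of `ζ_min`.

The cap is approached at high gain (`achievable_of_lt`). In the variable `x = (h s + η) / 2`, a
suitable `ki` turns the characteristic equation into `tanh x = x` modified by an all-pass factor of
the plant. As `kp → ∞` this modification disappears, and `tanh x = x` has no root with `re x > 0`
(`Complex.sinh_ne_mul_cosh`). Compactness carries this over to finite large gain on `re x ≥ δ`. -/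

/-! ### The equation `tanh x = x` in the right half-plane -/

theorem Real.sinh_lt_mul_cosh {p : ℝ} (hp : 0 < p) : Real.sinh p < p * Real.cosh p := by
  have hmono : StrictMonoOn (fun p : ℝ => p * Real.cosh p - Real.sinh p) (Set.Ici 0) := by
    refine strictMonoOn_of_deriv_pos (convex_Ici 0) (by fun_prop) fun x hx => ?_
    rw [interior_Ici, Set.mem_Ioi] at hx
    have hd : HasDerivAt (fun p : ℝ => p * Real.cosh p - Real.sinh p) (x * Real.sinh x) x :=
      (((hasDerivAt_id x).mul (Real.hasDerivAt_cosh x)).sub (Real.hasDerivAt_sinh x)).congr_deriv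
        (by simp)
    rw [hd.deriv]
    exact mul_pos hx (Real.sinh_pos_iff.mpr hx)
  have := hmono Set.self_mem_Ici (Set.mem_Ici.mpr hp.le) hp
  simp only [zero_mul, Real.sinh_zero, sub_zero] at this
  linarith

/-- The equation `tanh x = x` has no complex root in the open right half-plane. -/
theorem Complex.sinh_ne_mul_cosh {x : ℂ} (hx : 0 < x.re) :
    Complex.sinh x ≠ x * Complex.cosh x := by
  intro h
  obtain ⟨p, q⟩ := x
  dsimp only at hx
  have e : (⟨p, q⟩ : ℂ) = p + q * Complex.I := Complex.mk_eq_add_mul_I p q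
  rw [e, Complex.sinh_add, Complex.cosh_add, Complex.sinh_mul_I, Complex.cosh_mul_I,
    ← Complex.ofReal_sinh, ← Complex.ofReal_cosh, ← Complex.ofReal_sin, ← Complex.ofReal_cos] at h
  have hre := congrArg Complex.re h
  have him := congrArg Complex.im h
  simp only [Complex.add_re, Complex.mul_re, Complex.ofReal_re, Complex.ofReal_im, Complex.I_re,
    Complex.I_im, Complex.add_im, Complex.mul_im, mul_zero, mul_one, zero_mul, sub_zero, add_zero,
    zero_add, sub_self] at hre him
  have hsh : p < Real.sinh p := Real.self_lt_sinh_iff.mpr hx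
  have hch : 1 ≤ Real.cosh p := Real.one_le_cosh p
  have hlt := Real.sinh_lt_mul_cosh hx
  have hsq := Real.cosh_sq p
  have htr := Real.sin_sq_add_cos_sq q
  have hsin : |Real.sin q| ≤ |q| := Real.abs_sin_le_abs
  have hcos := Real.abs_cos_le_one q
  set S := Real.sinh p
  set C := Real.cosh p
  set u := Real.sin q
  set v := Real.cos q
  -- Multiply the equation by the conjugate of `cosh x`, using `|cosh x|² = S² + v²`, and take real
  -- and imaginary parts.
  have k1 : S * C = p * (S ^ 2 + v ^ 2) := by
    linear_combination (C * v) * hre + (S * u) * him + (p * v ^ 2) * hsq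
      + (p * S ^ 2 - S * C) * htr
  have k2 : u * v = q * (S ^ 2 + v ^ 2) := by
    linear_combination (C * v) * him - (S * u) * hre + (q * v ^ 2 - u * v) * hsq
      + (q * S ^ 2) * htr
  have hN : 1 < S ^ 2 + v ^ 2 := by
    have : p * 1 < p * (S ^ 2 + v ^ 2) := by
      rw [← k1]; nlinarith
    exact lt_of_mul_lt_mul_left this hx.le
  -- Since `|sin q cos q| ≤ |q|` and `|cosh x|² > 1`, `k2` leaves only the real axis.
  have hq : q = 0 := by
    by_contra hq
    have hq' : 0 < |q| := abs_pos.mpr hq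
    have h1 : |u| * |v| = |q| * (S ^ 2 + v ^ 2) := by
      rw [← abs_mul, k2, abs_mul, abs_of_pos (by linarith : 0 < S ^ 2 + v ^ 2)]
    have h2 : |u| * |v| ≤ |q| * 1 := mul_le_mul hsin hcos (abs_nonneg _) hq'.le
    nlinarith
  have hu : u = 0 := by simp [u, hq]
  have hv : v = 1 := by simp [v, hq]
  rw [hu, hv, hq] at hre
  linarith

/-- The left side is `2 exp (-x) (x cosh x - sinh x)`. -/
theorem sub_one_add_mul_exp_ne_zero {x : ℂ} (hx : 0 < x.re) :
    (x - 1) + (x + 1) * Complex.exp (-2 * x) ≠ 0 := by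
  intro h
  apply Complex.sinh_ne_mul_cosh hx
  have h1 : Complex.exp (-2 * x) = Complex.exp (-x) * Complex.exp (-x) := by
    rw [← Complex.exp_add]; congr 1; ring
  have h2 : Complex.exp x * Complex.exp (-x) = 1 := by
    rw [← Complex.exp_add]; simp
  rw [h1] at h
  rw [Complex.sinh, Complex.cosh]
  linear_combination (-Complex.exp x / 2) * h + ((x + 1) * Complex.exp (-x) / 2) * h2

/-! ### High-gain robustness -/

/-- Bounds the all-pass factor by `1 / q` slightly into its unstable side: the real parts compare
directly, and the imaginary parts agree while `q ≤ 1`. -/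
theorem mul_norm_sub_sub_lt {q m α C : ℝ} {x : ℂ} (hq0 : 0 < q) (hq1 : q < 1)
    (hm : -m ≤ x.re - α) (hm0 : 0 ≤ m) (hC : (1 + q) * m < (1 - q) * C) :
    q * ‖x - α - C‖ < ‖x - α + C‖ := by
  have hmC : m < C := by nlinarith
  have h1 : q * (x.re - α - C) < x.re - α + C := by nlinarith
  have h2 : -(x.re - α + C) < q * (x.re - α - C) := by nlinarith
  have hsq := sq_lt_sq' h2 h1
  refine lt_of_pow_lt_pow_left₀ 2 (norm_nonneg _) ?_
  rw [mul_pow, Complex.sq_norm, Complex.sq_norm, Complex.normSq_apply, Complex.normSq_apply]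
  simp only [Complex.sub_re, Complex.add_re, Complex.sub_im, Complex.add_im, Complex.ofReal_re,
    Complex.ofReal_im, sub_zero, add_zero]
  have : q ^ 2 ≤ 1 := by nlinarith
  nlinarith [mul_nonneg (sub_nonneg.mpr this) (sq_nonneg x.im)]

theorem mul_norm_add_one_le {q : ℝ} {x : ℂ} (hq0 : 0 < q) (hq1 : q < 1)
    (hx : (1 + q) / (1 - q) ≤ ‖x‖) : q * ‖x + 1‖ ≤ ‖x - 1‖ := by
  rw [div_le_iff₀ (by linarith)] at hx
  have h1 : ‖x + 1‖ ≤ ‖x‖ + 1 := by simpa using norm_add_le x 1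
  have h2 : ‖x‖ - 1 ≤ ‖x - 1‖ := by simpa using norm_sub_norm_le x 1
  nlinarith

/-- High-gain robustness: for large `C` the equation
`(x - α + C) (x - 1) = (x - α - C) (x + 1) exp (-2 x)`, obtained from `tanh x = x` by the first-order all-pass factor
`(x - α - C) / (x - α + C)` has no root with `δ ≤ re x`. -/
theorem exists_forall_ge_allpass_ne (α : ℝ) {δ : ℝ} (hδ : 0 < δ) :
    ∃ C₀ : ℝ, ∀ C : ℝ, C₀ ≤ C → ∀ x : ℂ, δ ≤ x.re →
      (x - α + C) * (x - 1) ≠ (x - α - C) * ((x + 1) * Complex.exp (-2 * x)) := by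
  obtain ⟨q, hq⟩ : ∃ q : ℝ, q = Real.exp (-δ) := ⟨_, rfl⟩
  have hq0 : 0 < q := hq ▸ Real.exp_pos _
  have hq1 : q < 1 := by rw [hq, Real.exp_lt_one_iff]; linarith
  obtain ⟨R, hR⟩ : ∃ R : ℝ, R = (1 + q) / (1 - q) := ⟨_, rfl⟩
  have hR1 : 1 < R := by rw [hR, lt_div_iff₀ (by linarith)]; linarith
  have hK : IsCompact (Metric.closedBall (0 : ℂ) R ∩ {x : ℂ | δ ≤ x.re}) :=
    (isCompact_closedBall 0 R).inter_right (isClosed_le continuous_const Complex.continuous_re)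
  obtain ⟨B, hB⟩ := hK.exists_bound_of_continuousOn
    (f := fun x : ℂ => (x - α) * ((x - 1) - (x + 1) * Complex.exp (-2 * x))
      / ((x - 1) + (x + 1) * Complex.exp (-2 * x)))
    (ContinuousOn.div (by fun_prop) (by fun_prop)
      fun x hx => sub_one_add_mul_exp_ne_zero (hδ.trans_le hx.2))
  refine ⟨max (max (B + 1) 1) ((1 + q) * |α| / (1 - q) + 1), fun C hC x hx heq => ?_⟩
  have hCB : B < C := by
    linarith [le_max_left (B + 1) 1, le_max_left (max (B + 1) 1) ((1 + q) * |α| / (1 - q) + 1)]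
  have hCpos : 0 < C := by
    linarith [le_max_right (B + 1) 1, le_max_left (max (B + 1) 1) ((1 + q) * |α| / (1 - q) + 1)]
  have hCq : (1 + q) * |α| < (1 - q) * C := by
    have : (1 + q) * |α| / (1 - q) < C := by
      linarith [le_max_right (max (B + 1) 1) ((1 + q) * |α| / (1 - q) + 1)]
    rw [div_lt_iff₀ (by linarith)] at this
    linarith
  rcases le_total ‖x‖ R with hxR | hxR
  -- Bounded `x`: the equation solved for `C` gives a continuous function of `x`, bounded by `B` on
  -- the compact set.
  · have hF := sub_one_add_mul_exp_ne_zero (hδ.trans_le hx)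
    have hb := hB x ⟨by simpa using hxR, hx⟩
    have : (x - α) * ((x - 1) - (x + 1) * Complex.exp (-2 * x))
        / ((x - 1) + (x + 1) * Complex.exp (-2 * x)) = -(C : ℂ) := by
      rw [div_eq_iff hF]
      linear_combination heq
    rw [this, norm_neg, Complex.norm_real, Real.norm_eq_abs, abs_of_pos hCpos] at hb
    linarith
  · have hn := congrArg norm heq
    -- Large `x`: one factor `q` absorbs the all-pass factor, the other absorbs `(x + 1) / (x - 1)`.
    have hexp : ‖Complex.exp (-2 * x)‖ ≤ q * q := by
      rw [Complex.norm_exp, hq, ← Real.exp_add, Real.exp_le_exp]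
      simp
      linarith
    have h1 := mul_norm_sub_sub_lt (x := x) (m := |α|) (α := α) hq0 hq1
      (by linarith [le_abs_self α]) (abs_nonneg α) hCq
    have h2 := mul_norm_add_one_le hq0 hq1 (hR ▸ hxR)
    have h3 : 0 < ‖x - 1‖ := by
      have : ‖x‖ - 1 ≤ ‖x - 1‖ := by simpa using norm_sub_norm_le x 1
      linarith
    simp only [norm_mul] at hn
    have : ‖x - α - C‖ * (‖x + 1‖ * ‖Complex.exp (-2 * x)‖)
        ≤ (q * ‖x - α - C‖) * ‖x - 1‖ := by
      calc ‖x - α - C‖ * (‖x + 1‖ * ‖Complex.exp (-2 * x)‖)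
          ≤ ‖x - α - C‖ * (‖x + 1‖ * (q * q)) := by gcongr
        _ = (q * ‖x - α - C‖) * (q * ‖x + 1‖) := by ring
        _ ≤ _ := by gcongr
    have := mul_lt_mul_of_pos_right h1 h3
    linarith

/-! ### Neutral root chains -/

open Filter in
theorem tendsto_add_div_add_cobounded {𝕜 : Type*} [NormedField 𝕜] (A B : 𝕜) :
    Tendsto (fun s : 𝕜 => (s + A) / (s + B)) (Bornology.cobounded 𝕜) (nhds 1) := by
  have h1 : Tendsto (fun s : 𝕜 => s + B) (Bornology.cobounded 𝕜) (Bornology.cobounded 𝕜) := by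
    rw [← tendsto_norm_atTop_iff_cobounded]
    refine tendsto_atTop_mono (fun s => ?_)
      (tendsto_atTop_add_const_right _ (-‖B‖) tendsto_norm_cobounded_atTop)
    have := norm_sub_norm_le s (-B)
    rw [norm_neg, sub_neg_eq_add] at this
    linarith
  have h2 : Tendsto (fun s : 𝕜 => 1 + (A - B) * (s + B)⁻¹) (Bornology.cobounded 𝕜) (nhds 1) := by
    simpa using ((tendsto_inv₀_cobounded.comp h1).const_mul (A - B)).const_add 1
  refine h2.congr' ?_
  filter_upwards [h1.eventually (Bornology.eventually_ne_cobounded 0)] with s hs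
  field_simp
  ring

open Filter Bornology in
/-- A neutral chain of roots: if `g` is holomorphic near infinity and tends to `1` there, then the
equation `exp (h s + L) = g s` has roots of real part arbitrarily close to `-L / h` and of
arbitrarily large modulus. -/
theorem exists_exp_eq_of_tendsto_cobounded {g : ℂ → ℂ} {h L ε : ℝ} (hh : 0 < h) (hε : 0 < ε)
    (hg : Tendsto g (cobounded ℂ) (nhds 1))
    (hd : ∀ᶠ s in cobounded ℂ, DifferentiableAt ℂ g s) {p : ℂ → Prop}
    (hp : ∀ᶠ s in cobounded ℂ, p s) :
    ∃ s : ℂ, Complex.exp (h * s + L) = g s ∧ |s.re + L / h| ≤ ε ∧ p s := by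
  obtain ⟨r, hr⟩ : ∃ r : ℝ, r = min ε (1 / (2 * h)) := ⟨_, rfl⟩
  have hr0 : 0 < r := by rw [hr]; positivity
  have hrε : r ≤ ε := hr ▸ min_le_left _ _
  have hrh : h * r ≤ 1 / 2 := by
    have : r ≤ 1 / (2 * h) := hr ▸ min_le_right _ _
    calc h * r ≤ h * (1 / (2 * h)) := by gcongr
      _ = 1 / 2 := by field_simp
  have hm : 0 < h * r / 16 := by positivity
  have hev : ∀ᶠ s in cobounded ℂ, ‖g s - 1‖ < h * r / 16 ∧ DifferentiableAt ℂ g s ∧ p s := by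
    filter_upwards [hg (Metric.ball_mem_nhds 1 hm), hd, hp] with s h1 h2 h3
    exact ⟨by simpa [dist_eq_norm] using h1, h2, h3⟩
  obtain ⟨R, -, hR⟩ := (hasBasis_cobounded_norm (E := ℂ)).eventually_iff.mp hev
  obtain ⟨n, hn⟩ := exists_nat_ge (h * (R + r))
  -- A root of `exp (h s + L) = 1`, high enough that the disc of radius `r` stays where `g` is close
  -- to `1`.
  obtain ⟨s₀, hs₀⟩ : ∃ s₀ : ℂ, s₀ = (-L + n * (2 * Real.pi * Complex.I)) / h := ⟨_, rfl⟩
  have hhc : (h : ℂ) ≠ 0 := by exact_mod_cast hh.ne'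
  have hre : s₀.re = -L / h := by
    rw [hs₀, Complex.div_ofReal_re]; simp
  have him : s₀.im = n * (2 * Real.pi) / h := by
    rw [hs₀, Complex.div_ofReal_im]; simp
  have hnorm : R + r ≤ ‖s₀‖ := by
    refine le_trans ?_ (Complex.im_le_norm s₀)
    rw [him, le_div_iff₀ hh]
    nlinarith [Real.pi_gt_three, (Nat.cast_nonneg n : (0 : ℝ) ≤ n)]
  have hexp : ∀ s : ℂ, Complex.exp (h * s + L) = Complex.exp (h * (s - s₀)) := by
    intro s
    have : (h : ℂ) * s + L = h * (s - s₀) + n * (2 * Real.pi * Complex.I) := by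
      rw [hs₀]; field_simp; ring
    rw [this, Complex.exp_add, Complex.exp_nat_mul_two_pi_mul_I, mul_one]
  have hball : ∀ s ∈ Metric.closedBall s₀ r,
      ‖g s - 1‖ < h * r / 16 ∧ DifferentiableAt ℂ g s ∧ p s := by
    intro s hs
    apply hR
    rw [Metric.mem_closedBall, dist_eq_norm] at hs
    have := norm_sub_norm_le s₀ s
    rw [norm_sub_rev] at this
    show R ≤ ‖s‖
    linarith
  set f : ℂ → ℂ := fun s => Complex.exp (h * (s - s₀)) - g s with hf
  have hs₀mem : s₀ ∈ Metric.closedBall s₀ r := Metric.mem_closedBall_self hr0.le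
  have hfs₀ : f s₀ = 1 - g s₀ := by simp [hf]
  have hdiff : DiffContOnCl ℂ f (Metric.ball s₀ r) := by
    apply DifferentiableOn.diffContOnCl
    intro s hs
    rw [closure_ball _ hr0.ne'] at hs
    exact (DifferentiableAt.sub (by fun_prop) (hball s hs).2.1).differentiableWithinAt
  -- The linear term has norm `h r`; the quadratic error is at most `(h r)² ≤ h r / 2`, and the
  -- variation of `g` below `h r / 8`.
  have hsphere : ∀ s ∈ Metric.sphere s₀ r, h * r / 4 ≤ ‖f s - f s₀‖ := by
    intro s hs
    have hs1 := (hball s (Metric.sphere_subset_closedBall hs)).1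
    have hs2 := (hball s₀ hs₀mem).1
    rw [mem_sphere_iff_norm] at hs
    have hw : ‖(h : ℂ) * (s - s₀)‖ = h * r := by
      rw [norm_mul, hs, Complex.norm_real, Real.norm_eq_abs, abs_of_pos hh]
    have h1 := Complex.norm_exp_sub_one_sub_id_le (x := (h : ℂ) * (s - s₀)) (by rw [hw]; linarith)
    rw [hw] at h1
    have h2 : (h : ℂ) * (s - s₀) = (f s - f s₀) - (Complex.exp (h * (s - s₀)) - 1 - h * (s - s₀))
        + (g s - 1) - (g s₀ - 1) := by
      rw [hfs₀, hf]; ring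
    have h3 := norm_sub_le ((f s - f s₀) - (Complex.exp (h * (s - s₀)) - 1 - h * (s - s₀))
        + (g s - 1)) (g s₀ - 1)
    have h4 := norm_add_le ((f s - f s₀) - (Complex.exp (h * (s - s₀)) - 1 - h * (s - s₀)))
        (g s - 1)
    have h5 := norm_sub_le (f s - f s₀) (Complex.exp (h * (s - s₀)) - 1 - h * (s - s₀))
    rw [← h2, hw] at h3
    nlinarith
  have hfreq : ∃ᶠ s in nhds s₀, f s ≠ f s₀ := by
    intro hcon
    have hcon' : ∀ᶠ s in nhds s₀, f s = f s₀ := hcon.mono fun s hs => not_not.mp hs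
    have hana : AnalyticOnNhd ℂ f (Metric.ball s₀ r) :=
      hdiff.differentiableOn.analyticOnNhd Metric.isOpen_ball
    have heq := hana.eqOn_of_preconnected_of_eventuallyEq analyticOnNhd_const
      (convex_ball s₀ r).isPreconnected (Metric.mem_ball_self hr0) hcon'
    have hcl : Set.EqOn f (fun _ => f s₀) (Metric.closedBall s₀ r) := by
      rw [← closure_ball _ hr0.ne']
      exact heq.of_subset_closure hdiff.continuousOn continuousOn_const subset_closure subset_rfl
    have hpt : s₀ + r ∈ Metric.sphere s₀ r := by
      simp [abs_of_pos hr0]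
    have := hsphere _ hpt
    rw [hcl (Metric.sphere_subset_closedBall hpt), sub_self, norm_zero] at this
    nlinarith
  -- The quantitative open mapping theorem covers radius `h r / 8` around `f s₀`, while `‖f s₀‖ < h
  -- r / 16`.
  have h0 : (0 : ℂ) ∈ Metric.ball (f s₀) (h * r / 4 / 2) := by
    rw [mem_ball_iff_norm, zero_sub, norm_neg, hfs₀, norm_sub_rev]
    linarith [(hball s₀ hs₀mem).1]
  obtain ⟨s, hs, hfs⟩ := hdiff.ball_subset_image_closedBall hr0 hsphere hfreq h0
  refine ⟨s, ?_, ?_, (hball s hs).2.2⟩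
  · rw [hexp]
    exact sub_eq_zero.mp hfs
  · rw [Metric.mem_closedBall, dist_eq_norm] at hs
    have := (Complex.abs_re_le_norm (s - s₀)).trans hs
    rw [Complex.sub_re, hre, neg_div, sub_neg_eq_add] at this
    exact this.trans hrε

/-! ### Upper bound and attainment of decay rates -/

theorem charQuasi_eq (P : LoopParams) (s : ℂ) :
    charQuasi P s = (s + P.a + P.b * P.d) * ((P.kp + P.d) * s + P.ki)
      - Complex.exp (-((P.h1 : ℂ) + (P.h2 : ℂ)) * s)
        * ((s + P.a - P.b * P.d) * ((P.kp - P.d) * s + P.ki)) := by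
  rw [charQuasi]
  ring

open Filter Bornology in
/-- The neutral part of the closed loop bounds every achievable decay rate. -/
theorem Achievable.mul_le_log {a b h1 h2 ζ σ : ℝ} (hh : 0 < h1 + h2) (hζ0 : 0 < ζ) (hζ1 : ζ < 1)
    (hA : Achievable a b h1 h2 ζ σ) : σ * (h1 + h2) ≤ Real.log ((1 + ζ) / (1 - ζ)) := by
  obtain ⟨k, ki, -, -, hd, hs⟩ := hA
  have hk : 0 < k := pos_of_mul_pos_right hd hζ0.le
  by_contra! hlt
  obtain ⟨L, hL⟩ : ∃ L : ℝ, L = Real.log ((1 + ζ) / (1 - ζ)) := ⟨_, rfl⟩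
  have hexpL : Complex.exp L = (1 + ζ) / (1 - ζ) := by
    rw [← Complex.ofReal_exp, hL, Real.exp_log (div_pos (by linarith) (by linarith))]
    push_cast
    rfl
  rw [← hL] at hlt
  -- With this tolerance the chain contains a root with `re s ≥ -σ`.
  have hε : 0 < σ - L / (h1 + h2) := by
    rw [sub_pos, div_lt_iff₀ hh]
    exact hlt
  have hkc : (k : ℂ) ≠ 0 := by exact_mod_cast hk.ne'
  have hp1 : (1 + ζ : ℂ) ≠ 0 := by exact_mod_cast (by linarith : (1 + ζ : ℝ) ≠ 0)
  have hm1 : (1 - ζ : ℂ) ≠ 0 := by exact_mod_cast (by linarith : (1 - ζ : ℝ) ≠ 0)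
  have hev : ∀ᶠ s : ℂ in cobounded ℂ,
      s + (a + b * (ζ * k) : ℂ) ≠ 0 ∧ s + (ki / (k * (1 + ζ)) : ℂ) ≠ 0 := by
    filter_upwards [eventually_ne_cobounded (-(a + b * (ζ * k)) : ℂ),
      eventually_ne_cobounded (-(ki / (k * (1 + ζ))) : ℂ)] with s h1 h2
    exact ⟨fun h => h1 (eq_neg_of_add_eq_zero_left h),
      fun h => h2 (eq_neg_of_add_eq_zero_left h)⟩
  obtain ⟨s, hsg, hre, hs1, hs2⟩ := exists_exp_eq_of_tendsto_cobounded (L := L)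
    (g := fun s : ℂ => (s + (a - b * (ζ * k))) / (s + (a + b * (ζ * k)))
      * ((s + ki / (k * (1 - ζ))) / (s + ki / (k * (1 + ζ))))) hh hε
    (by simpa using (tendsto_add_div_add_cobounded (a - b * (ζ * k) : ℂ) _).mul
          (tendsto_add_div_add_cobounded (ki / (k * (1 - ζ)) : ℂ) _))
    (hev.mono fun s ⟨hs1, hs2⟩ => by fun_prop (disch := assumption)) hev
  have hroot : s.re < -σ := by
    apply hs
    rw [isCharRoot_iff _ hd.ne', charQuasi_eq]
    dsimp only
    have hE : Complex.exp (-((h1 : ℂ) + (h2 : ℂ)) * s) * Complex.exp ((h1 + h2 : ℝ) * s + L)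
        = (1 + ζ) / (1 - ζ) := by
      rw [← hexpL, ← Complex.exp_add]; congr 1; push_cast; ring
    rw [div_mul_div_comm, eq_div_iff (mul_ne_zero hs1 hs2)] at hsg
    rw [eq_div_iff hm1] at hE
    have f1 : (k + (ζ * k : ℝ) : ℂ) * s + ki = k * (1 + ζ) * (s + ki / (k * (1 + ζ))) := by
      push_cast; field_simp
    have f2 : (k - (ζ * k : ℝ) : ℂ) * s + ki = k * (1 - ζ) * (s + ki / (k * (1 - ζ))) := by
      push_cast; field_simp
    rw [f1, f2]
    push_cast at hE hsg ⊢
    linear_combination (-(k : ℂ) * (s + (a + b * (ζ * k))) * (s + ki / (k * (1 + ζ)))) * hE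
      + (Complex.exp (-((h1 : ℂ) + (h2 : ℂ)) * s) * k * (1 - ζ)) * hsg
  linarith [(abs_le.mp hre).1]

theorem achievable_of_lt {a b h1 h2 ζ η σ : ℝ} (hb : 0 < b) (hh : 0 < h1 + h2)
    (hζ0 : 0 < ζ) (hζ1 : ζ < 1) (hη : 0 < η) (hζη : ζ * η = 2)
    (hexp : Real.exp η * (1 - ζ) = 1 + ζ) (hσ : σ < η / (h1 + h2)) :
    Achievable a b h1 h2 ζ σ := by
  obtain ⟨h, hhdef⟩ : ∃ h, h = h1 + h2 := ⟨_, rfl⟩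
  rw [← hhdef] at hh hσ
  rw [lt_div_iff₀ hh] at hσ
  obtain ⟨C₀, hC₀⟩ := exists_forall_ge_allpass_ne ((η - a * h) / 2)
    (δ := (η - σ * h) / 2) (by linarith)
  obtain ⟨C, hC⟩ : ∃ C, C = max C₀ 1 := ⟨_, rfl⟩
  have hC0 : 0 < C := by rw [hC]; positivity
  obtain ⟨k, hk⟩ : ∃ k, k = 2 * C / (b * ζ * h) := ⟨_, rfl⟩
  have hk0 : 0 < k := by rw [hk]; positivity
  have hCk : b * (ζ * k) * h = 2 * C := by rw [hk]; field_simp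
  have hζ2 : 0 ≤ 1 - ζ ^ 2 := by nlinarith
  -- This `ki` and `ζ η = 2` make the controller factors proportional to `x - 1` and `x + 1`; `k`
  -- makes the plant factors proportional to `x - α ± C`, with `α = (η - a h) / 2`.
  refine ⟨k, k * (η / h * (1 - ζ ^ 2)), hk0.le, by positivity, by positivity, fun s hs => ?_⟩
  rw [isCharRoot_iff _ (mul_pos hζ0 hk0).ne', charQuasi_eq] at hs
  dsimp only at hs
  by_contra! hre
  obtain ⟨x, hx⟩ : ∃ x : ℂ, x = (h * s + η) / 2 := ⟨_, rfl⟩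
  have hxre : (η - σ * h) / 2 ≤ x.re := by
    have : x.re = (h * s.re + η) / 2 := by
      rw [hx, show ((2 : ℂ)) = ((2 : ℝ) : ℂ) by norm_num, Complex.div_ofReal_re]; simp
    rw [this]
    nlinarith
  refine hC₀ C (hC ▸ le_max_left _ _) x hxre ?_
  have hz : Complex.exp (-((h1 : ℂ) + (h2 : ℂ)) * s) * (1 - ζ)
      = Complex.exp (-2 * x) * (1 + ζ) := by
    have e1 : (1 + ζ : ℂ) = Complex.exp η * (1 - ζ) := by
      rw [← Complex.ofReal_exp]; exact_mod_cast hexp.symm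
    have e2 : -((h1 : ℂ) + (h2 : ℂ)) * s = -2 * x + η := by
      rw [hx, hhdef]; push_cast; ring
    rw [e2, Complex.exp_add, e1]
    ring
  have hhc : (h : ℂ) ≠ 0 := by exact_mod_cast hh.ne'
  have hkc : (k : ℂ) ≠ 0 := by exact_mod_cast hk0.ne'
  have hp1 : (1 + ζ : ℂ) ≠ 0 := by exact_mod_cast (by linarith : (1 + ζ : ℝ) ≠ 0)
  have hsx : s = (2 * x - η) / h := by rw [hx]; field_simp; ring
  have hζη' : (ζ : ℂ) * η = 2 := by exact_mod_cast hζη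
  have hCk' : (b : ℂ) * (ζ * k) * h = 2 * C := by exact_mod_cast hCk
  have f1 : ((k + (ζ * k : ℝ) : ℂ) * s + (k * (η / h * (1 - ζ ^ 2)) : ℝ))
      = 2 / h * k * (1 + ζ) * (x - 1) := by
    rw [hsx]; push_cast; field_simp
    linear_combination (-1 - ζ) * hζη'
  have f2 : ((k - (ζ * k : ℝ) : ℂ) * s + (k * (η / h * (1 - ζ ^ 2)) : ℝ))
      = 2 / h * k * (1 - ζ) * (x + 1) := by
    rw [hsx]; push_cast; field_simp
    linear_combination (1 - ζ) * hζη'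
  have f3 : s + a + b * (ζ * k : ℝ) = 2 / h * (x - ((η - a * h) / 2 : ℝ) + C) := by
    rw [hsx]; push_cast; field_simp
    linear_combination hCk'
  have f4 : s + a - b * (ζ * k : ℝ) = 2 / h * (x - ((η - a * h) / 2 : ℝ) - C) := by
    rw [hsx]; push_cast; field_simp
    linear_combination -hCk'
  rw [f1, f2, f3, f4] at hs
  have hne : (2 / h * (2 / h * k * (1 + ζ)) : ℂ) ≠ 0 := by
    simp [hhc, hkc, hp1]
  apply mul_left_cancel₀ hne
  linear_combination hs + (2 / h * (2 / h * k)
    * ((x - ((η - a * h) / 2 : ℝ) - C) * (x + 1)) : ℂ) * hz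

/-! ### The number `η_sup` -/

theorem EtaEq.exp_mul_sub_two {η : ℝ} (h : EtaEq η) : Real.exp η * (η - 2) = η + 2 := by
  rw [EtaEq] at h
  linear_combination -h

theorem EtaEq.two_lt {η : ℝ} (h : EtaEq η) (hη : 0 < η) : 2 < η := by
  have := h.exp_mul_sub_two
  by_contra! hle
  nlinarith [Real.exp_pos η]

/-- On `η > 2`, `exp η` increases while `(η + 2) / (η - 2)` decreases. -/
theorem EtaEq.eq_of_pos {η η' : ℝ} (h : EtaEq η) (h' : EtaEq η') (hη : 0 < η) (hη' : 0 < η') :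
    η = η' := by
  have key : ∀ {x y : ℝ}, EtaEq x → EtaEq y → 0 < x → 0 < y → ¬ x < y := by
    intro x y hx hy hx0 hy0 hxy
    have h1 := hx.exp_mul_sub_two
    have h2 := hy.exp_mul_sub_two
    have h3 := hx.two_lt hx0
    have h4 := mul_lt_mul_of_pos_right (Real.exp_lt_exp.mpr hxy)
      (mul_pos (sub_pos.mpr h3) (sub_pos.mpr (h3.trans hxy)))
    nlinarith
  exact le_antisymm (not_lt.mp (key h' h hη' hη)) (not_lt.mp (key h h' hη hη'))

theorem EtaEq.zetaOf_eq {η : ℝ} (h : EtaEq η) (hη : 0 < η) : zetaOf η = 2 / η := by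
  have h1 := h.exp_mul_sub_two
  have h2 := h.two_lt hη
  have he : Real.exp η = (η + 2) / (η - 2) := by
    rw [eq_div_iff (by linarith)]; exact h1
  have h3 : η - 2 ≠ 0 := by linarith
  have h4 : 0 < 2 * η * Real.exp η - (1 + Real.exp η) * (1 - Real.exp η) := by
    nlinarith [Real.one_lt_exp_iff.mpr hη, mul_pos hη (Real.exp_pos η)]
  rw [zetaOf, div_eq_div_iff h4.ne' hη.ne', he]
  field_simp
  ring

theorem exp_bounds_near_etaEq :
    Real.exp 2.39935 * 0.39935 < 4.39935 ∧ 4.39937 < Real.exp 2.39937 * 0.39937 := by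
  constructor
  -- Dividing by 4 brings the argument into `[0, 1]`, as the Taylor bound requires.
  · have h := Real.exp_bound' (x := 2.39935 / 4) (by norm_num) (by norm_num) (n := 10) (by norm_num)
    have e : Real.exp 2.39935 = Real.exp (2.39935 / 4) ^ 4 := by
      rw [← Real.exp_nat_mul]; norm_num
    have := pow_le_pow_left₀ (Real.exp_pos _).le h 4
    rw [e]
    refine (mul_le_mul_of_nonneg_right this (by norm_num)).trans_lt ?_
    norm_num [Finset.sum_range_succ, Nat.factorial]
  · have h := Real.sum_le_exp_of_nonneg (x := 2.39937 / 4) (by norm_num) 10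
    have e : Real.exp 2.39937 = Real.exp (2.39937 / 4) ^ 4 := by
      rw [← Real.exp_nat_mul]; norm_num
    have := pow_le_pow_left₀ (by positivity) h 4
    rw [e]
    refine lt_of_lt_of_le ?_ (mul_le_mul_of_nonneg_right this (by norm_num))
    norm_num [Finset.sum_range_succ, Nat.factorial]

theorem exists_etaEq : ∃ η : ℝ, EtaEq η ∧ 2.39935 ≤ η ∧ η ≤ 2.39937 := by
  have hc : ContinuousOn (fun η : ℝ => 2 * (1 + Real.exp η) + η * (1 - Real.exp η))
      (Set.Icc 2.39935 2.39937) := by fun_prop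
  obtain ⟨h1, h2⟩ := exp_bounds_near_etaEq
  obtain ⟨η, hη, h0⟩ := intermediate_value_Icc' (by norm_num) hc
    (show (0 : ℝ) ∈ _ by constructor <;> linarith)
  exact ⟨η, h0, hη.1, hη.2⟩

/-! ### The main theorem -/

theorem theorem1 :
    ∃ η : ℝ,
      (0 < η ∧ EtaEq η ∧ ∀ η' : ℝ, 0 < η' → EtaEq η' → η' = η) ∧
      |η - 2.3994| ≤ 0.00005 ∧
      |zetaOf η - 0.8336| ≤ 0.00005 ∧
      ∀ a b h1 h2 : ℝ, 0 ≤ a → 0 < b → 0 ≤ h1 → 0 ≤ h2 → 0 < h1 + h2 →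
        IsLUB {σ : ℝ | Achievable a b h1 h2 (zetaOf η) σ} (η / (h1 + h2)) ∧
        IsLeast {ζ : ℝ | 0 < ζ ∧ ∀ σ : ℝ, σ < η / (h1 + h2) → Achievable a b h1 h2 ζ σ}
          (zetaOf η) := by
  obtain ⟨η, hη, hlo, hhi⟩ := exists_etaEq
  have hη0 : 0 < η := by linarith
  have hη2 : 2 < η := by linarith
  refine ⟨η, ⟨hη0, hη, fun η' h0 h => h.eq_of_pos hη h0 hη0⟩, ?_, ?_, ?_⟩
  · rw [abs_le]; constructor <;> linarith
  · rw [hη.zetaOf_eq hη0, abs_le]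
    constructor
    · rw [le_sub_iff_add_le, le_div_iff₀ hη0]; linarith
    · rw [sub_le_iff_le_add, div_le_iff₀ hη0]; linarith
  intro a b h1 h2 _ hb _ _ hh
  rw [hη.zetaOf_eq hη0]
  have hζ0 : 0 < 2 / η := by positivity
  have hζ1 : 2 / η < 1 := by rw [div_lt_one hη0]; exact hη2
  have hexp : Real.exp η * (1 - 2 / η) = 1 + 2 / η := by
    field_simp
    exact hη.exp_mul_sub_two
  have hlog : Real.log ((1 + 2 / η) / (1 - 2 / η)) = η := by
    rw [← hexp, mul_div_cancel_right₀ _ (by linarith), Real.log_exp]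
  have hach : ∀ σ : ℝ, σ < η / (h1 + h2) → Achievable a b h1 h2 (2 / η) σ := fun σ hσ =>
    achievable_of_lt hb hh hζ0 hζ1 hη0 (by field_simp) hexp hσ
  refine ⟨⟨fun σ hσ => ?_, fun B hB => le_of_forall_lt fun σ hσ => ?_⟩, ⟨hζ0, hach⟩,
    fun ζ ⟨hζ, hall⟩ => ?_⟩
  · rw [le_div_iff₀ hh, ← hlog]
    exact hσ.mul_le_log hh hζ0 hζ1
  · obtain ⟨τ, h1, h2⟩ := exists_between hσ
    exact h1.trans_le (hB (hach τ h2))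
  · by_contra! hlt
    have hζ1' : ζ < 1 := hlt.trans hζ1
    have hL : Real.log ((1 + ζ) / (1 - ζ)) < η := by
      rw [← hlog]
      refine Real.log_lt_log (div_pos (by linarith) (by linarith)) ?_
      rw [div_lt_div_iff₀ (by linarith) (by linarith)]
      nlinarith
    -- For `ζ < ζ_min` the cap lies strictly below `η`, so a rate between the two contradicts it.
    obtain ⟨τ, ht1, ht2⟩ := exists_between hL
    have := (hall (τ / (h1 + h2)) (div_lt_div_of_pos_right ht2 hh)).mul_le_log hh hζ hζ1'
    rw [div_mul_cancel₀ _ hh.ne'] at this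
    linarith
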